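/- Let $\mathbb{D}\subset\mathbb{C}$ be the open unit disc and let $\partial=\tfrac12(\partial_x-i\partial_y)$, $\bar\partial=\tfrac12(\partial_x+i\partial_y)$ be the Wirtinger derivatives. For $\gamma_1,\gamma_2\in\mathbb{C}$, a function $u\in C^2(\mathbb{D})$ (complex-valued) is called $(\gamma_1,\gamma_2)$-harmonic on $\mathbb{D}$ if $$(1-|z|^2)\,\partial\bar\partial u+\gamma_1 z\,\partial u+\gamma_2\bar z\,\bar\partial u-\gamma_1\gamma_2 u=0\quad\text{in }\mathbb{D}.$$ For an integer $n\ge 0$, a function $u\in C^{2n}(\mathbb{D})$ is called polyharmonic of order $n$ on $\mathbb{D}$ if $\partial^n\bar\partial^n u=0$ in $\mathbb{D}$. Let $\gamma_1,\gamma_2\ge 0$ be integers and let $u\in C^\infty(\mathbb{D})$ be $(\gamma_1,\gamma_2)$-harmonic on $\mathbb{D}$. Then there are functions $P_1,P_2,P_3\in C^\infty(\mathbb{D})$ with $$u(z)=P_1(z)+P_2(z)+P_3(z),\qquad z\in\mathbb{D},$$ such that $P_1$ is polyharmonic of order $\gamma_1+1$, $P_2$ is polyharmonic of order $\gamma_2+1$,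 and $P_3$ is polyharmonic of order $\min(\gamma_1+1,\gamma_2+1)$. Moreover, $u$ is polyharmonic of order $\max(\gamma_1+1,\gamma_2+1)$ on $\mathbb{D}$. In particular, for every integer $n\ge 1$, every $(n-1,n-1)$-harmonic function $u\in C^\infty(\mathbb{D})$ is polyharmonic of order $n$ on $\mathbb{D}$. -/

import Mathlib

open scoped ContDiff

namespace GenHarmonic

/-- The open unit disc in `ℂ`. -/
def disc : Set ℂ := Metric.ball 0 1

/-- The Wirtinger derivative `∂ = (∂ₓ - i ∂ᵧ) / 2`. -/
noncomputable def dz (f : ℂ → ℂ) (z : ℂ) : ℂ :=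
  (fderiv ℝ f z 1 - Complex.I * fderiv ℝ f z Complex.I) / 2

/-- The Wirtinger derivative `∂̄ = (∂ₓ + i ∂ᵧ) / 2`. -/
noncomputable def dzbar (f : ℂ → ℂ) (z : ℂ) : ℂ :=
  (fderiv ℝ f z 1 + Complex.I * fderiv ℝ f z Complex.I) / 2

/-- The operator `L = (1 - |z|²) ∂∂̄ + γ₁ z ∂ + γ₂ z̄ ∂̄ - γ₁ γ₂`. -/
noncomputable def L (γ₁ γ₂ : ℂ) (u : ℂ → ℂ) (z : ℂ) : ℂ :=
  (1 - (‖z‖ : ℂ) ^ 2) * dz (dzbar u) z + γ₁ * z * dz u z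
    + γ₂ * (starRingEnd ℂ) z * dzbar u z - γ₁ * γ₂ * u z

/-- `u` restricts to an element of `C^∞(𝔻)`. Only the values of `u` on the disc matter. -/
def SmoothOnDisc (u : ℂ → ℂ) : Prop := ContDiffOn ℝ ∞ u disc

/-- `u` is a `(γ₁, γ₂)`-harmonic function on the disc: a `C²` solution of `L u = 0`. -/
def IsHarmonicWith (γ₁ γ₂ : ℂ) (u : ℂ → ℂ) : Prop :=
  ContDiffOn ℝ 2 u disc ∧ ∀ z ∈ disc, L γ₁ γ₂ u z = 0

/-- `u` is polyharmonic of order `n` on the disc: `u ∈ C^{2n}` and `∂ⁿ ∂̄ⁿ u = 0`. -/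
def IsPolyharmonic (n : ℕ) (u : ℂ → ℂ) : Prop :=
  ContDiffOn ℝ (2 * n : ℕ) u disc ∧ ∀ z ∈ disc, dz^[n] (dzbar^[n] u) z = 0

end GenHarmonic

namespace GenHarmonic

/-! Each Wirtinger derivative lowers one parameter of the operator: ∂̄ carries solutions of `L a b`
to solutions of `L (a - 1) b`, and ∂ to solutions of `L a (b - 1)` (`dzbar_L`, `dz_L`). For natural
parameters m, n, the function w = ∂ⁿ∂̄ᵐu thus solves `L 0 0 w = 0`, that is (1 - |z|²)∂∂̄w = 0, and
the factor has no zero in the disc. Hence ∂ⁿ⁺¹∂̄ᵐ⁺¹u = 0, and further derivatives raise both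
exponents to their maximum. The decomposition follows at once, as one of its three slots already
allows that order. -/

lemma isOpen_disc : IsOpen disc := Metric.isOpen_ball

lemma disc_mem_nhds {z : ℂ} (hz : z ∈ disc) : disc ∈ nhds z := isOpen_disc.mem_nhds hz

/-! ### Calculus of the Wirtinger derivatives -/

/-- Derivatives are local and the disc is open, so identities known only on the disc may be
differentiated. -/
lemma dz_congr {f g : ℂ → ℂ} (h : Set.EqOn f g disc) : Set.EqOn (dz f) (dz g) disc := by
  intro z hz
  have := (h.eventuallyEq_of_mem (disc_mem_nhds hz)).fderiv_eq (𝕜 := ℝ)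
  simp only [dz, this]

lemma dzbar_congr {f g : ℂ → ℂ} (h : Set.EqOn f g disc) :
    Set.EqOn (dzbar f) (dzbar g) disc := by
  intro z hz
  have := (h.eventuallyEq_of_mem (disc_mem_nhds hz)).fderiv_eq (𝕜 := ℝ)
  simp only [dzbar, this]

lemma SmoothOnDisc.fderiv_apply {f : ℂ → ℂ} (hf : SmoothOnDisc f) (v : ℂ) :
    SmoothOnDisc (fun z => fderiv ℝ f z v) :=
  (hf.fderiv_of_isOpen isOpen_disc (m := ∞) (by simp)).clm_apply contDiffOn_const

lemma SmoothOnDisc.dz {f : ℂ → ℂ} (hf : SmoothOnDisc f) : SmoothOnDisc (dz f) :=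
  ((hf.fderiv_apply 1).sub (contDiffOn_const.mul (hf.fderiv_apply Complex.I))).div_const 2

lemma SmoothOnDisc.dzbar {f : ℂ → ℂ} (hf : SmoothOnDisc f) : SmoothOnDisc (dzbar f) :=
  ((hf.fderiv_apply 1).add (contDiffOn_const.mul (hf.fderiv_apply Complex.I))).div_const 2

lemma SmoothOnDisc.differentiableAt {f : ℂ → ℂ} (hf : SmoothOnDisc f) {z : ℂ} (hz : z ∈ disc) :
    DifferentiableAt ℝ f z :=
  (ContDiffOn.contDiffAt hf (disc_mem_nhds hz)).differentiableAt (by simp)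

lemma SmoothOnDisc.iterate_dz {f : ℂ → ℂ} (hf : SmoothOnDisc f) (k : ℕ) :
    SmoothOnDisc (GenHarmonic.dz^[k] f) := by
  induction k with
  | zero => exact hf
  | succ k ih => rw [Function.iterate_succ_apply']; exact ih.dz

lemma SmoothOnDisc.iterate_dzbar {f : ℂ → ℂ} (hf : SmoothOnDisc f) (k : ℕ) :
    SmoothOnDisc (GenHarmonic.dzbar^[k] f) := by
  induction k with
  | zero => exact hf
  | succ k ih => rw [Function.iterate_succ_apply']; exact ih.dzbar

section Rules

variable {f g : ℂ → ℂ} {z : ℂ}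

lemma dz_add (hf : DifferentiableAt ℝ f z) (hg : DifferentiableAt ℝ g z) :
    dz (fun w => f w + g w) z = dz f z + dz g z := by
  simp only [dz, fderiv_fun_add hf hg, add_apply]
  ring

lemma dzbar_add (hf : DifferentiableAt ℝ f z) (hg : DifferentiableAt ℝ g z) :
    dzbar (fun w => f w + g w) z = dzbar f z + dzbar g z := by
  simp only [dzbar, fderiv_fun_add hf hg, add_apply]
  ring

lemma dz_sub (hf : DifferentiableAt ℝ f z) (hg : DifferentiableAt ℝ g z) :
    dz (fun w => f w - g w) z = dz f z - dz g z := by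
  simp only [dz, fderiv_fun_sub hf hg, sub_apply]
  ring

lemma dzbar_sub (hf : DifferentiableAt ℝ f z) (hg : DifferentiableAt ℝ g z) :
    dzbar (fun w => f w - g w) z = dzbar f z - dzbar g z := by
  simp only [dzbar, fderiv_fun_sub hf hg, sub_apply]
  ring

lemma dz_mul (hf : DifferentiableAt ℝ f z) (hg : DifferentiableAt ℝ g z) :
    dz (fun w => f w * g w) z = f z * dz g z + dz f z * g z := by
  simp only [dz, fderiv_fun_mul hf hg, add_apply, smul_apply, smul_eq_mul]
  ring

lemma dzbar_mul (hf : DifferentiableAt ℝ f z) (hg : DifferentiableAt ℝ g z) :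
    dzbar (fun w => f w * g w) z = f z * dzbar g z + dzbar f z * g z := by
  simp only [dzbar, fderiv_fun_mul hf hg, add_apply, smul_apply, smul_eq_mul]
  ring

lemma dz_const (c z : ℂ) : dz (fun _ => c) z = 0 := by simp [dz]

lemma dzbar_const (c z : ℂ) : dzbar (fun _ => c) z = 0 := by simp [dzbar]

lemma dz_id (z : ℂ) : dz (fun w => w) z = 1 := by simp [dz]

lemma dzbar_id (z : ℂ) : dzbar (fun w => w) z = 0 := by simp [dzbar]

lemma hasFDerivAt_conj (z : ℂ) :
    HasFDerivAt (𝕜 := ℝ) (fun w => (starRingEnd ℂ) w) (Complex.conjCLE : ℂ →L[ℝ] ℂ) z :=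
  (Complex.conjCLE : ℂ →L[ℝ] ℂ).hasFDerivAt

lemma dz_conj (z : ℂ) : dz (fun w => (starRingEnd ℂ) w) z = 0 := by
  simp [dz, (hasFDerivAt_conj z).fderiv]

lemma dzbar_conj (z : ℂ) : dzbar (fun w => (starRingEnd ℂ) w) z = 1 := by
  simp [dzbar, (hasFDerivAt_conj z).fderiv]

end Rules

lemma two_le_infty : (2 : WithTop ℕ∞) ≤ ∞ := by
  simpa using (by exact_mod_cast le_top : ((2 : ℕ∞) : WithTop ℕ∞) ≤ ∞)

/-- Rewrites repeated directional derivatives through the bilinear second derivative, whose symmetry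
gives `dzbar_dz`. -/
lemma fderiv_fderiv_apply {f : ℂ → ℂ} (hf : SmoothOnDisc f) {z : ℂ} (hz : z ∈ disc) (v w : ℂ) :
    fderiv ℝ (fun y => fderiv ℝ f y v) z w = fderiv ℝ (fderiv ℝ f) z w v := by
  have h : DifferentiableAt ℝ (fderiv ℝ f) z :=
    ((ContDiffOn.contDiffAt hf (disc_mem_nhds hz)).fderiv_right (m := 1)
      (one_add_one_eq_two.trans_le two_le_infty)).differentiableAt (by simp)
  rw [fderiv_clm_apply h (differentiableAt_const v)]
  simp

/-- The two Wirtinger derivatives commute on smooth functions. -/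
lemma dzbar_dz {f : ℂ → ℂ} (hf : SmoothOnDisc f) :
    Set.EqOn (dzbar (dz f)) (dz (dzbar f)) disc := by
  intro z hz
  have hsymm : fderiv ℝ (fderiv ℝ f) z 1 Complex.I = fderiv ℝ (fderiv ℝ f) z Complex.I 1 :=
    ((ContDiffOn.contDiffAt hf (disc_mem_nhds hz)).isSymmSndFDerivAt
      (by simpa using two_le_infty)) 1 Complex.I
  have h1 := (hf.fderiv_apply 1).differentiableAt hz
  have hI := (hf.fderiv_apply Complex.I).differentiableAt hz
  have e1 : ∀ v, fderiv ℝ (dz f) z v = (fderiv ℝ (fderiv ℝ f) z v 1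
      - Complex.I * fderiv ℝ (fderiv ℝ f) z v Complex.I) / 2 := by
    intro v
    have h := ((h1.hasFDerivAt.sub (hI.hasFDerivAt.const_mul Complex.I)).mul_const (2 : ℂ)⁻¹)
    have h' : HasFDerivAt (𝕜 := ℝ) (dz f) _ z := h.congr_of_eventuallyEq
      (Filter.Eventually.of_forall fun y => by simp [dz, div_eq_mul_inv])
    rw [h'.fderiv]
    simp [fderiv_fderiv_apply hf hz]
    ring
  have e2 : ∀ v, fderiv ℝ (dzbar f) z v = (fderiv ℝ (fderiv ℝ f) z v 1
      + Complex.I * fderiv ℝ (fderiv ℝ f) z v Complex.I) / 2 := by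
    intro v
    have h := ((h1.hasFDerivAt.add (hI.hasFDerivAt.const_mul Complex.I)).mul_const (2 : ℂ)⁻¹)
    have h' : HasFDerivAt (𝕜 := ℝ) (dzbar f) _ z := h.congr_of_eventuallyEq
      (Filter.Eventually.of_forall fun y => by simp [dzbar, div_eq_mul_inv])
    rw [h'.fderiv]
    simp [fderiv_fderiv_apply hf hz]
    ring
  simp only [dz, dzbar] at e1 e2 ⊢
  rw [e1, e1, e2, e2, hsymm]
  ring

lemma dzbar_iterate_dz {f : ℂ → ℂ} (hf : SmoothOnDisc f) (k : ℕ) :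
    Set.EqOn (dzbar (dz^[k] f)) (dz^[k] (dzbar f)) disc := by
  induction k with
  | zero => exact fun _ _ => rfl
  | succ k ih =>
    rw [Function.iterate_succ_apply', Function.iterate_succ_apply']
    exact (dzbar_dz (hf.iterate_dz k)).trans (dz_congr ih)

lemma iterate_dz_congr {f g : ℂ → ℂ} (h : Set.EqOn f g disc) (k : ℕ) :
    Set.EqOn (dz^[k] f) (dz^[k] g) disc := by
  induction k with
  | zero => exact h
  | succ k ih =>
    rw [Function.iterate_succ_apply', Function.iterate_succ_apply']
    exact dz_congr ih

lemma iterate_dzbar_congr {f g : ℂ → ℂ} (h : Set.EqOn f g disc) (k : ℕ) :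
    Set.EqOn (dzbar^[k] f) (dzbar^[k] g) disc := by
  induction k with
  | zero => exact h
  | succ k ih =>
    rw [Function.iterate_succ_apply', Function.iterate_succ_apply']
    exact dzbar_congr ih

lemma iterate_dzbar_iterate_dz {f : ℂ → ℂ} (hf : SmoothOnDisc f) (j k : ℕ) :
    Set.EqOn (dzbar^[j] (dz^[k] f)) (dz^[k] (dzbar^[j] f)) disc := by
  induction j with
  | zero => exact fun _ _ => rfl
  | succ j ih =>
    rw [Function.iterate_succ_apply', Function.iterate_succ_apply']
    exact (dzbar_congr ih).trans (dzbar_iterate_dz (hf.iterate_dzbar j) k)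

lemma iterate_dz_zero (k : ℕ) : dz^[k] (fun _ => 0) = fun _ => 0 :=
  Function.iterate_fixed (funext fun z => dz_const 0 z) k

lemma iterate_dzbar_zero (k : ℕ) : dzbar^[k] (fun _ => 0) = fun _ => 0 :=
  Function.iterate_fixed (funext fun z => dzbar_const 0 z) k

/-! ### Commutation of `L` with the Wirtinger derivatives -/

lemma L_eq (a b : ℂ) (u : ℂ → ℂ) : L a b u = fun z =>
    (1 - z * (starRingEnd ℂ) z) * dz (dzbar u) z + a * z * dz u z
      + b * (starRingEnd ℂ) z * dzbar u z - a * b * u z := by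
  funext z
  rw [L, Complex.mul_conj']

/-- `∂ L_{a,b} = L_{a,b-1} ∂`. -/
lemma dz_L (a b : ℂ) {u : ℂ → ℂ} (hu : SmoothOnDisc u) :
    Set.EqOn (dz (L a b u)) (L a (b - 1) (dz u)) disc := by
  intro z hz
  have h0 := hu.differentiableAt hz
  have h1 := hu.dz.differentiableAt hz
  have h2 := hu.dzbar.differentiableAt hz
  have h3 := hu.dzbar.dz.differentiableAt hz
  have hc := (hasFDerivAt_conj z).differentiableAt
  have hi : DifferentiableAt ℝ (fun w : ℂ => w) z := differentiableAt_id
  have hk : ∀ c : ℂ, DifferentiableAt ℝ (fun _ : ℂ => c) z := differentiableAt_const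
  have hm : DifferentiableAt ℝ (fun w => w * (starRingEnd ℂ) w) z := hi.fun_mul hc
  have hs : DifferentiableAt ℝ (fun w => 1 - w * (starRingEnd ℂ) w) z := (hk 1).fun_sub hm
  have ha : DifferentiableAt ℝ (fun w => a * w) z := (hk a).fun_mul hi
  have hb : DifferentiableAt ℝ (fun w => b * (starRingEnd ℂ) w) z := (hk b).fun_mul hc
  rw [L_eq, L_eq, dz_sub (((hs.fun_mul h3).fun_add (ha.fun_mul h1)).fun_add (hb.fun_mul h2)) ((hk (a * b)).fun_mul h0),
    dz_add ((hs.fun_mul h3).fun_add (ha.fun_mul h1)) (hb.fun_mul h2), dz_add (hs.fun_mul h3) (ha.fun_mul h1),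
    dz_mul hs h3, dz_mul ha h1, dz_mul hb h2, dz_mul (hk (a * b)) h0, dz_sub (hk 1) hm,
    dz_mul hi hc, dz_mul (hk a) hi, dz_mul (hk b) hc]
  -- Differentiating 1 - zz̄ yields -z̄∂∂̄u, which turns b into b - 1; differentiating az yields
  -- a∂u, which turns -ab into -a(b - 1).
  simp only [dz_const, dz_id, dz_conj, dzbar_dz hu hz, dz_congr (dzbar_dz hu) hz]
  ring

/-- `∂̄ L_{a,b} = L_{a-1,b} ∂̄`. -/
lemma dzbar_L (a b : ℂ) {u : ℂ → ℂ} (hu : SmoothOnDisc u) :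
    Set.EqOn (dzbar (L a b u)) (L (a - 1) b (dzbar u)) disc := by
  intro z hz
  have h0 := hu.differentiableAt hz
  have h1 := hu.dz.differentiableAt hz
  have h2 := hu.dzbar.differentiableAt hz
  have h3 := hu.dzbar.dz.differentiableAt hz
  have hc := (hasFDerivAt_conj z).differentiableAt
  have hi : DifferentiableAt ℝ (fun w : ℂ => w) z := differentiableAt_id
  have hk : ∀ c : ℂ, DifferentiableAt ℝ (fun _ : ℂ => c) z := differentiableAt_const
  have hm : DifferentiableAt ℝ (fun w => w * (starRingEnd ℂ) w) z := hi.fun_mul hc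
  have hs : DifferentiableAt ℝ (fun w => 1 - w * (starRingEnd ℂ) w) z := (hk 1).fun_sub hm
  have ha : DifferentiableAt ℝ (fun w => a * w) z := (hk a).fun_mul hi
  have hb : DifferentiableAt ℝ (fun w => b * (starRingEnd ℂ) w) z := (hk b).fun_mul hc
  rw [L_eq, L_eq, dzbar_sub (((hs.fun_mul h3).fun_add (ha.fun_mul h1)).fun_add (hb.fun_mul h2)) ((hk (a * b)).fun_mul h0),
    dzbar_add ((hs.fun_mul h3).fun_add (ha.fun_mul h1)) (hb.fun_mul h2), dzbar_add (hs.fun_mul h3) (ha.fun_mul h1),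
    dzbar_mul hs h3, dzbar_mul ha h1, dzbar_mul hb h2, dzbar_mul (hk (a * b)) h0,
    dzbar_sub (hk 1) hm, dzbar_mul hi hc, dzbar_mul (hk a) hi, dzbar_mul (hk b) hc]
  simp only [dzbar_const, dzbar_id, dzbar_conj, dzbar_dz hu hz, dzbar_dz hu.dzbar hz]
  ring

/-! ### Polyharmonicity -/

lemma iterate_dzbar_L_eq_zero (m : ℕ) (a b : ℂ) {u : ℂ → ℂ} (hu : SmoothOnDisc u)
    (h : Set.EqOn (L a b u) (fun _ => 0) disc) :
    Set.EqOn (L (a - m) b (dzbar^[m] u)) (fun _ => 0) disc := by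
  induction m with
  | zero => simpa using h
  | succ m ih =>
    rw [Function.iterate_succ_apply', Nat.cast_succ, ← sub_sub]
    intro z hz
    rw [← dzbar_L _ _ (hu.iterate_dzbar m) hz, dzbar_congr ih hz, dzbar_const]

lemma iterate_dz_L_eq_zero (n : ℕ) (a b : ℂ) {u : ℂ → ℂ} (hu : SmoothOnDisc u)
    (h : Set.EqOn (L a b u) (fun _ => 0) disc) :
    Set.EqOn (L a (b - n) (dz^[n] u)) (fun _ => 0) disc := by
  induction n with
  | zero => simpa using h
  | succ n ih =>
    rw [Function.iterate_succ_apply', Nat.cast_succ, ← sub_sub]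
    intro z hz
    rw [← dz_L _ _ (hu.iterate_dz n) hz, dz_congr ih hz, dz_const]

/-- With both parameters zero only (1 - |z|²)∂∂̄w survives, and |z| < 1 allows division. -/
lemma dz_dzbar_eq_zero_of_L_zero {w : ℂ → ℂ} (h : Set.EqOn (L 0 0 w) (fun _ => 0) disc) :
    Set.EqOn (dz (dzbar w)) (fun _ => 0) disc := by
  intro z hz
  have hL := h hz
  simp only [L, zero_mul, add_zero, sub_zero] at hL
  refine (mul_eq_zero.mp hL).resolve_left fun h0 => ?_
  have hz' : ‖z‖ < 1 := by simpa [disc] using hz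
  have h1 : 1 - ‖z‖ ^ 2 = 0 := by exact_mod_cast h0
  nlinarith [norm_nonneg z]

/-- A smooth `(m, n)`-harmonic function satisfies `∂ⁿ⁺¹ ∂̄ᵐ⁺¹ u = 0`. -/
theorem IsHarmonicWith.iterate_eq_zero {m n : ℕ} {u : ℂ → ℂ} (hu : SmoothOnDisc u)
    (h : IsHarmonicWith m n u) :
    Set.EqOn (dz^[n + 1] (dzbar^[m + 1] u)) (fun _ => 0) disc := by
  have h1 := iterate_dz_L_eq_zero n _ _ (hu.iterate_dzbar m) (iterate_dzbar_L_eq_zero m _ _ hu h.2)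
  -- The parameters have reached m - m and n - n.
  rw [sub_self, sub_self] at h1
  intro z hz
  rw [← dz_dzbar_eq_zero_of_L_zero h1 hz, Function.iterate_succ_apply',
    Function.iterate_succ_apply']
  exact (dz_congr (dzbar_iterate_dz (hu.iterate_dzbar m) n) hz).symm

theorem IsHarmonicWith.isPolyharmonic {m n N : ℕ} {u : ℂ → ℂ} (hu : SmoothOnDisc u)
    (h : IsHarmonicWith m n u) (hm : m + 1 ≤ N) (hn : n + 1 ≤ N) : IsPolyharmonic N u := by
  refine ⟨ContDiffOn.of_le hu (WithTop.coe_le_coe.2 (le_top (a := ((2 * N : ℕ) : ℕ∞)))), ?_⟩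
  obtain ⟨j, rfl⟩ := Nat.exists_eq_add_of_le' hm
  obtain ⟨k, hk⟩ := Nat.exists_eq_add_of_le' hn
  have key : Set.EqOn (dz^[n + 1] (dzbar^[j + (m + 1)] u)) (fun _ => 0) disc := by
    rw [Function.iterate_add_apply dzbar]
    -- The j surplus ∂̄ are moved outside ∂ⁿ⁺¹, where they act on a function vanishing on the disc.
    refine (iterate_dzbar_iterate_dz (hu.iterate_dzbar (m + 1)) j (n + 1)).symm.trans ?_
    refine (iterate_dzbar_congr (IsHarmonicWith.iterate_eq_zero hu h) j).trans ?_
    rw [iterate_dzbar_zero]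
    exact fun _ _ => rfl
  intro z hz
  have := iterate_dz_congr key k hz
  rwa [iterate_dz_zero, ← Function.iterate_add_apply, ← hk] at this

lemma isPolyharmonic_zero (n : ℕ) : IsPolyharmonic n (fun _ => 0) :=
  ⟨contDiffOn_const, fun z _ => by rw [iterate_dzbar_zero, iterate_dz_zero]⟩

end GenHarmonic

theorem mainTheorem4 :
    (∀ (γ₁ γ₂ : ℕ) (u : ℂ → ℂ), GenHarmonic.SmoothOnDisc u →
      GenHarmonic.IsHarmonicWith γ₁ γ₂ u →
        (∃ P₁ P₂ P₃ : ℂ → ℂ,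
          GenHarmonic.SmoothOnDisc P₁ ∧ GenHarmonic.SmoothOnDisc P₂ ∧
          GenHarmonic.SmoothOnDisc P₃ ∧
          GenHarmonic.IsPolyharmonic (γ₁ + 1) P₁ ∧
          GenHarmonic.IsPolyharmonic (γ₂ + 1) P₂ ∧
          GenHarmonic.IsPolyharmonic (min (γ₁ + 1) (γ₂ + 1)) P₃ ∧
          ∀ z ∈ GenHarmonic.disc, u z = P₁ z + P₂ z + P₃ z) ∧
        GenHarmonic.IsPolyharmonic (max (γ₁ + 1) (γ₂ + 1)) u) ∧
    (∀ (n : ℕ) (u : ℂ → ℂ), 0 < n → GenHarmonic.SmoothOnDisc u →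
      GenHarmonic.IsHarmonicWith ((n : ℂ) - 1) ((n : ℂ) - 1) u →
        GenHarmonic.IsPolyharmonic n u) := by
  -- Since `u` itself is polyharmonic of order `max (γ₁ + 1) (γ₂ + 1)`, it serves as `P₁` or `P₂`.
  refine ⟨fun m n u hu h => ?_, fun n u hn hu h => ?_⟩
  · have hmax := h.isPolyharmonic hu (le_max_left (m + 1) (n + 1)) (le_max_right _ _)
    refine ⟨?_, hmax⟩
    have h0 : GenHarmonic.SmoothOnDisc (fun _ => 0) := contDiffOn_const
    rcases le_total n m with hnm | hmn
    · rw [max_eq_left (by omega)] at hmax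
      exact ⟨u, fun _ => 0, fun _ => 0, hu, h0, h0, hmax, GenHarmonic.isPolyharmonic_zero _,
        GenHarmonic.isPolyharmonic_zero _, fun z _ => by simp⟩
    · rw [max_eq_right (by omega)] at hmax
      exact ⟨fun _ => 0, u, fun _ => 0, h0, hu, h0, GenHarmonic.isPolyharmonic_zero _, hmax,
        GenHarmonic.isPolyharmonic_zero _, fun z _ => by simp⟩
  · obtain ⟨k, rfl⟩ := Nat.exists_eq_add_of_le' hn
    -- With n = k + 1, the complex parameter n - 1 is the cast of k.
    have h' : GenHarmonic.IsHarmonicWith (k : ℕ) (k : ℕ) u := by simpa using h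
    exact h'.isPolyharmonic hu le_rfl le_rfl
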